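/- Let $\alpha>0$, let $dA$ be area measure on $\mathbb{C}$ and $d\lambda_\alpha(z)=\frac{\alpha}{\pi}e^{-\alpha|z|^2}\,dA(z)$. Let $F^\infty_\alpha$ be the space of entire functions $f$ with $\|f\|_{\infty,\alpha}=\operatorname{ess\,sup}_{z\in\mathbb{C}}|f(z)|e^{-\alpha|z|^2/2}<\infty$, normed by $\|\cdot\|_{\infty,\alpha}$. Let $BMO$ be the class of locally integrable functions $\varphi:\mathbb{C}\to\mathbb{C}$ such that, for some $r>0$, $$\sup_{z\in\mathbb{C}}\frac{1}{\pi r^2}\int_{B(z,r)}\Big|\varphi(w)-\frac{1}{\pi r^2}\int_{B(z,r)}\varphi\,dA\Big|\,dA(w)<\infty .$$ For $\varphi\in BMO$ let $$T_\varphi f(z)=\int_{\mathbb{C}}\varphi(w)f(w)e^{\alpha z\bar w}\,d\lambda_\alpha(w)\quad(f\in F^\infty_\alpha),\qquad \tilde\varphi_t(z)=\frac{\alpha}{\pi}\int_{\mathbb{C}}\varphi(w)e^{-\frac{\alpha t}{2}|z-w|^2}\,dA(w)\quad(t>0).$$ Theorem. Let $\varphi\in BMO$. If $T_\varphi$ is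 a compact operator from $F^\infty_\alpha$ to itself, then for every $t>0$ the integral defining $\tilde\varphi_t(z)$ converges absolutely for every $z\in\mathbb{C}$ and $\tilde\varphi_t\in C_0(\mathbb{C})$, that is, $\tilde\varphi_t$ is continuous and tends to $0$ at infinity. -/

import Mathlib

open MeasureTheory Filter Topology ComplexConjugate

noncomputable section

namespace Fock

/-- The weighted function `z ↦ f z * exp (-α |z|² / 2)`. -/
def weighted (α : ℝ) (f : ℂ → ℂ) : ℂ → ℂ :=
  fun z => f z * (Real.exp (-(α * ‖z‖ ^ 2 / 2)) : ℂ)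

/-- The entire functions `f` for which `f z * exp (-α |z|² / 2)` is essentially bounded with
respect to area measure, as a linear subspace of all functions `ℂ → ℂ`. -/
def inftySubmodule (α : ℝ) : Submodule ℂ (ℂ → ℂ) where
  carrier := {f | Differentiable ℂ f ∧ MemLp (weighted α f) ⊤ volume}
  add_mem' := by
    rintro f g ⟨hf, hf'⟩ ⟨hg, hg'⟩
    refine ⟨hf.add hg, ?_⟩
    have h : weighted α (f + g) = weighted α f + weighted α g := by
      funext z
      simp [weighted, add_mul]
    rw [h]
    exact hf'.add hg'
  zero_mem' := by
    refine ⟨differentiable_const 0, ?_⟩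
    have h : weighted α 0 = 0 := by
      funext z
      simp [weighted]
    rw [h]
    exact MemLp.zero
  smul_mem' := by
    rintro c f ⟨hf, hf'⟩
    refine ⟨hf.const_smul c, ?_⟩
    have h : weighted α (c • f) = c • weighted α f := by
      funext z
      simp [weighted, mul_assoc]
    rw [h]
    exact hf'.const_smul c

/-- The Fock space `F^∞_α`. It is a type of its own (not a reducible synonym of a subspace of
`ℂ → ℂ`), so that it carries only the topology of its norm, defined below, and not that of
pointwise convergence. -/
def FInfty (α : ℝ) : Type := inftySubmodule α

instance (α : ℝ) : AddCommGroup (FInfty α) :=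
  inferInstanceAs (AddCommGroup (inftySubmodule α))

instance (α : ℝ) : Module ℂ (FInfty α) :=
  inferInstanceAs (Module ℂ (inftySubmodule α))

instance (α : ℝ) : CoeFun (FInfty α) (fun _ => ℂ → ℂ) := ⟨fun f => f.1⟩

/-- The linear map `f ↦ f · exp (-α |·|² / 2)` from `F^∞_α` to `L^∞(ℂ, dA)`. -/
def FInfty.toLinfty (α : ℝ) : FInfty α →ₗ[ℂ] Lp ℂ ⊤ (volume : Measure ℂ) where
  toFun f := f.2.2.toLp (weighted α f)
  map_add' f g := by
    rw [← MemLp.toLp_add]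
    refine MemLp.toLp_congr _ _ (Eventually.of_forall fun z => ?_)
    exact add_mul (f z) (g z) _
  map_smul' c f := by
    rw [RingHom.id_apply, ← MemLp.toLp_const_smul]
    refine MemLp.toLp_congr _ _ (Eventually.of_forall fun z => ?_)
    exact mul_assoc c (f z) _

theorem FInfty.toLinfty_injective (α : ℝ) : Function.Injective (FInfty.toLinfty α) := by
  intro f g h
  have h1 : weighted α f =ᵐ[volume] weighted α g := (MemLp.toLp_eq_toLp_iff f.2.2 g.2.2).1 h
  have hc : ∀ k : FInfty α, Continuous (weighted α k) := by
    intro k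
    have hk : Continuous k.1 := k.2.1.continuous
    unfold weighted
    fun_prop
  have h2 : weighted α f = weighted α g := (hc f).ae_eq_iff_eq volume (hc g) |>.1 h1
  refine Subtype.ext (funext fun z => ?_)
  have h3 := congrFun h2 z
  exact mul_right_cancel₀ (Complex.ofReal_ne_zero.2 (Real.exp_ne_zero _)) h3

/-- The norm of `F^∞_α` is `‖f‖ = ess sup |f z| exp (-α |z|² / 2)`. -/
instance (α : ℝ) : NormedAddCommGroup (FInfty α) :=
  NormedAddCommGroup.induced (FInfty α) (Lp ℂ ⊤ (volume : Measure ℂ)) (FInfty.toLinfty α)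
    (FInfty.toLinfty_injective α)

instance (α : ℝ) : NormedSpace ℂ (FInfty α) :=
  NormedSpace.induced ℂ (FInfty α) (Lp ℂ ⊤ (volume : Measure ℂ)) (FInfty.toLinfty α)

theorem FInfty.norm_def (α : ℝ) (f : FInfty α) :
    ‖f‖ = (eLpNorm (weighted α f) ⊤ volume).toReal :=
  Lp.norm_toLp _ f.2.2

/-- The Gaussian measure `dλ_α(z) = (α / π) exp (-α |z|²) dA(z)`. -/
def gaussian (α : ℝ) : Measure ℂ :=
  volume.withDensity fun z => ENNReal.ofReal (α / Real.pi * Real.exp (-(α * ‖z‖ ^ 2)))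

/-- The reproducing kernel `K_z(w) = exp (α * conj z * w)`. -/
def kernel (α : ℝ) (z w : ℂ) : ℂ := Complex.exp (α * conj z * w)

/-- The Toeplitz integral `T_φ f (z) = ∫ φ(w) f(w) conj (K_z(w)) dλ_α(w)`. -/
def toeplitz (α : ℝ) (φ f : ℂ → ℂ) (z : ℂ) : ℂ :=
  ∫ w, φ w * f w * conj (kernel α z w) ∂(gaussian α)

/-- `T_φ` is a compact operator on `F^∞_α`: it maps `F^∞_α` into itself, as a bounded linear
operator that is compact. -/
def IsCompactToeplitz (α : ℝ) (φ : ℂ → ℂ) : Prop :=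
  ∃ T : FInfty α →L[ℂ] FInfty α,
    (∀ (f : FInfty α) (z : ℂ), T f z = toeplitz α φ f z) ∧ IsCompactOperator T

/-- Functions of bounded mean oscillation over the disks of some fixed radius. The class does not
depend on the radius, and contains the functions whose mean oscillation is bounded over all
disks. -/
def BMO (φ : ℂ → ℂ) : Prop :=
  LocallyIntegrable φ volume ∧
    ∃ r > 0, ∃ C : ℝ, ∀ z : ℂ,
      ⨍ w in Metric.ball z r, ‖φ w - ⨍ u in Metric.ball z r, φ u‖ ≤ C

/-- The integrand of the `t`-Berezin transform of `φ` at `z`, without the factor `α / π`. -/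
def berezinIntegrand (α t : ℝ) (φ : ℂ → ℂ) (z w : ℂ) : ℂ :=
  φ w * (Real.exp (-(α * t * ‖z - w‖ ^ 2 / 2)) : ℂ)

/-- The `t`-Berezin transform `(α / π) ∫ φ(w) exp (-α t |z - w|² / 2) dA(w)`. -/
def berezin (α t : ℝ) (φ : ℂ → ℂ) (z : ℂ) : ℂ :=
  (α / Real.pi : ℂ) * ∫ w, berezinIntegrand α t φ z w

end Fock

end

noncomputable section

namespace Fock

/-! Up to a constant, the transforms in the theorem are the heat transforms `heat φ s` with `s = α t
/ 2`; the value `s = α` is the Berezin transform. Testing `T` on the normalized kernel at `z` and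
evaluating at `z` bounds `heat φ α z` by a constant times the norm of the image. The images tend to
zero pointwise and lie in a compact set, so they tend to zero in norm. Hence `heat φ α` is bounded
and vanishes at infinity. It remains to change the exponent. Towards smaller `s` this is forward
heat flow: `heat φ s` is a Gaussian convolution of `heat φ α` (`BMO.heat_eq_integral`). Towards
larger `s` the heat flow must be reversed, and this needs `BMO`: mean oscillation against Gaussians
is bounded, so boundedness of one heat transform of `φ` bounds every heat transform of `|φ|`. A
narrow Gaussian is then approximated, relative to a wider one, by combinations of Gaussians of
exponent at most `7 s / 9` (`exists_polynomial_abs_pow_sub_le`), so decay passes from `(0, 7 s / 9]`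
to `s`. Iterating with ratio `9 / 7` reaches every exponent. -/

/-- The Gaussian `exp (-s |z - w|²)`. -/
def gauss (s : ℝ) (z w : ℂ) : ℝ := Real.exp (-(s * ‖z - w‖ ^ 2))

/-- The unnormalized heat transform `∫ φ(w) exp (-s |z - w|²) dA(w)`. -/
def heat (φ : ℂ → ℂ) (s : ℝ) (z : ℂ) : ℂ := ∫ w, φ w * (gauss s z w : ℂ)

/-- Dominated convergence along a filter requires it to be countably generated. -/
instance : (cocompact ℂ).IsCountablyGenerated := by
  rw [← Metric.cobounded_eq_cocompact, ← comap_norm_atTop]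
  infer_instance

/-! ### Elementary properties of Gaussians -/

theorem gauss_pos (s : ℝ) (z w : ℂ) : 0 < gauss s z w := Real.exp_pos _

theorem continuous_gauss (s : ℝ) : Continuous fun p : ℂ × ℂ => gauss s p.1 p.2 := by
  unfold gauss
  fun_prop

theorem continuous_gauss_left (s : ℝ) (z : ℂ) : Continuous (gauss s z) := by
  unfold gauss
  fun_prop

theorem integrable_gauss {s : ℝ} (hs : 0 < s) (z : ℂ) : Integrable (gauss s z) := by
  have h := (GaussianFourier.integrable_cexp_neg_mul_sq_norm_add (V := ℂ) (b := (s : ℂ))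
    (by simpa using hs) 0 0).norm.comp_sub_left z
  refine h.congr (Eventually.of_forall fun w => ?_)
  simp [gauss, Complex.norm_exp, ← Complex.ofReal_pow]

theorem integral_gauss (s : ℝ) (z : ℂ) : ∫ w, gauss s z w = ∫ w, gauss s 0 w := by
  have h := integral_sub_left_eq_self (fun w : ℂ => gauss s 0 w) volume z
  rw [← h]
  refine integral_congr_ae (Eventually.of_forall fun w => ?_)
  simp [gauss, norm_sub_rev]

theorem integral_gauss_pos {s : ℝ} (hs : 0 < s) (z : ℂ) : 0 < ∫ w, gauss s z w :=
  (integral_pos_iff_support_of_nonneg (fun w => (gauss_pos s z w).le) (integrable_gauss hs z)).2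
    (by
      have : Function.support (gauss s z) = Set.univ :=
        Set.eq_univ_of_forall fun w => (gauss_pos s z w).ne'
      simp [this])

/-- Moving the centre of a Gaussian by at most `r` costs a factor and half of the exponent. -/
theorem gauss_le_of_norm_sub_le {s r : ℝ} (hs : 0 ≤ s) {z w u v : ℂ}
    (h : ‖(z - w) - (u - v)‖ ≤ r) :
    gauss s z w ≤ Real.exp (s * r ^ 2) * gauss (s / 2) u v := by
  unfold gauss
  rw [← Real.exp_add]
  refine Real.exp_le_exp.2 ?_
  have h1 : ‖u - v‖ ≤ ‖z - w‖ + r := by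
    have := norm_sub_le (z - w) ((z - w) - (u - v))
    rw [sub_sub_cancel] at this
    linarith
  have h2 : ‖u - v‖ ^ 2 ≤ 2 * ‖z - w‖ ^ 2 + 2 * r ^ 2 := by
    nlinarith [norm_nonneg (u - v), norm_nonneg (z - w), sq_nonneg (‖z - w‖ - r)]
  nlinarith

/-! ### Disk integrals and the growth of local averages -/

theorem volume_real_ball (z : ℂ) (r : ℝ) :
    volume.real (Metric.ball z r) = volume.real (Metric.ball (0 : ℂ) r) :=
  Measure.addHaar_real_ball_center volume z r

theorem volume_real_ball_pos {r : ℝ} (hr : 0 < r) : 0 < volume.real (Metric.ball (0 : ℂ) r) :=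
  ENNReal.toReal_pos (Metric.measure_ball_pos volume _ hr).ne' measure_ball_lt_top.ne

theorem integrableOn_ball {φ : ℂ → ℂ} (hφ : LocallyIntegrable φ) (z : ℂ) (r : ℝ) :
    IntegrableOn φ (Metric.ball z r) :=
  (hφ.integrableOn_isCompact (isCompact_closedBall z r)).mono_set Metric.ball_subset_closedBall

theorem integrableOn_ball_norm_sub {φ : ℂ → ℂ} (hφ : LocallyIntegrable φ) (z : ℂ) (r : ℝ) (c : ℂ) :
    IntegrableOn (fun w => ‖φ w - c‖) (Metric.ball z r) :=
  ((integrableOn_ball hφ z r).sub (integrableOn_const measure_ball_lt_top.ne)).norm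

theorem setIntegral_norm_sub_le {φ : ℂ → ℂ} {r C : ℝ} (hr : 0 < r) (z c : ℂ)
    (h : ⨍ w in Metric.ball z r, ‖φ w - c‖ ≤ C) :
    ∫ w in Metric.ball z r, ‖φ w - c‖ ≤ volume.real (Metric.ball (0 : ℂ) r) * C := by
  rw [setAverage_eq, volume_real_ball, smul_eq_mul, inv_mul_le_iff₀ (volume_real_ball_pos hr)] at h
  exact h

section MeanOscillation

variable {φ A : ℂ → ℂ} {r C : ℝ}

/-- The disk of radius `r / 2` about the midpoint lies in both disks of radius `r`, so on it `φ` is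
close in mean to both `A z` and `A z'`. -/
theorem norm_average_sub_le_of_norm_sub_le (hφ : LocallyIntegrable φ) (hr : 0 < r)
    (h : ∀ z, ∫ w in Metric.ball z r, ‖φ w - A z‖ ≤ C) {z z' : ℂ} (hz : ‖z - z'‖ ≤ r) :
    ‖A z - A z'‖ ≤ 2 * C / volume.real (Metric.ball (0 : ℂ) (r / 2)) := by
  have hV := volume_real_ball_pos (half_pos hr)
  set m : ℂ := (z + z') / 2 with hm
  have hsub : ∀ x : ℂ, ‖x - m‖ ≤ r / 2 → Metric.ball m (r / 2) ⊆ Metric.ball x r := by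
    intro x hx
    refine Metric.ball_subset_ball' ?_
    rw [dist_comm, dist_eq_norm]
    linarith
  have hz1 : ‖z - m‖ ≤ r / 2 := by
    have : z - m = (z - z') / 2 := by rw [hm]; ring
    rw [this, norm_div]
    simpa using by linarith
  have hz2 : ‖z' - m‖ ≤ r / 2 := by
    have : z' - m = -((z - z') / 2) := by rw [hm]; ring
    rw [this, norm_neg, norm_div]
    simpa using by linarith
  have hi : ∀ x : ℂ, ‖x - m‖ ≤ r / 2 → ∫ w in Metric.ball m (r / 2), ‖φ w - A x‖ ≤ C := fun x hx =>
    (setIntegral_mono_set (integrableOn_ball_norm_sub hφ x r (A x))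
      (Eventually.of_forall fun w => norm_nonneg _) (hsub x hx).eventuallyLE).trans (h x)
  rw [le_div_iff₀ hV]
  have e : ∫ _w in Metric.ball m (r / 2), ‖A z - A z'‖
      = ‖A z - A z'‖ * volume.real (Metric.ball (0 : ℂ) (r / 2)) := by
    rw [setIntegral_const, volume_real_ball, smul_eq_mul, mul_comm]
  rw [← e]
  calc ∫ _w in Metric.ball m (r / 2), ‖A z - A z'‖
      ≤ ∫ w in Metric.ball m (r / 2), (‖φ w - A z‖ + ‖φ w - A z'‖) := by
        refine setIntegral_mono (integrableOn_const measure_ball_lt_top.ne)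
          ((integrableOn_ball_norm_sub hφ m _ _).add (integrableOn_ball_norm_sub hφ m _ _))
          fun w => ?_
        have := norm_sub_le (φ w - A z') (φ w - A z)
        rw [sub_sub_sub_cancel_left] at this
        simpa [add_comm] using this
    _ = _ := integral_add (integrableOn_ball_norm_sub hφ m _ _)
          (integrableOn_ball_norm_sub hφ m _ _)
    _ ≤ 2 * C := by linarith [hi z hz1, hi z' hz2]

theorem norm_sub_le_nat_mul {D : ℝ}
    (h : ∀ z z' : ℂ, ‖z - z'‖ ≤ r → ‖A z - A z'‖ ≤ D) (n : ℕ) :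
    ∀ z z' : ℂ, ‖z - z'‖ ≤ n * r → ‖A z - A z'‖ ≤ n * D := by
  induction n with
  | zero =>
    intro z z' hz
    have : z = z' := by simpa [sub_eq_zero] using hz
    simp [this]
  | succ n ih =>
    intro z z' hz
    have hn : (0 : ℝ) < n + 1 := by positivity
    push_cast at hz ⊢
    -- The first of `n + 1` equal steps along the segment from `z'` to `z`; the induction hypothesis
    -- covers the rest.
    set x : ℂ := z' + ((1 / (n + 1) : ℝ) : ℂ) * (z - z') with hx
    have h1 : ‖x - z'‖ ≤ r := by
      rw [hx, add_sub_cancel_left, norm_mul, Complex.norm_real, Real.norm_of_nonneg (by positivity),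
        div_mul_eq_mul_div, one_mul, div_le_iff₀ hn]
      linarith
    have h2 : ‖z - x‖ ≤ n * r := by
      have : z - x = ((n / (n + 1) : ℝ) : ℂ) * (z - z') := by
        have hc : ((n : ℂ) + 1) ≠ 0 := by exact_mod_cast hn.ne'
        rw [hx]; push_cast; field_simp; ring
      rw [this, norm_mul, Complex.norm_real, Real.norm_of_nonneg (by positivity),
        div_mul_eq_mul_div, div_le_iff₀ hn]
      nlinarith [mul_le_mul_of_nonneg_left hz (Nat.cast_nonneg (α := ℝ) n)]
    have := norm_sub_le_norm_sub_add_norm_sub (A z) (A x) (A z')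
    linarith [h x z' h1, ih z x h2]

/-- Chaining `⌈‖z - z'‖ / r⌉` steps of length at most `r` makes the drift of the averages at most
linear, which a Gaussian can absorb. -/
theorem exists_norm_average_sub_le (hφ : LocallyIntegrable φ) (hr : 0 < r)
    (h : ∀ z, ∫ w in Metric.ball z r, ‖φ w - A z‖ ≤ C) :
    ∃ D, 0 ≤ D ∧ ∀ z z', ‖A z - A z'‖ ≤ D * (‖z - z'‖ + 1) := by
  set E := 2 * C / volume.real (Metric.ball (0 : ℂ) (r / 2)) with hE
  have hloc : ∀ z z' : ℂ, ‖z - z'‖ ≤ r → ‖A z - A z'‖ ≤ E := fun z z' hz =>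
    norm_average_sub_le_of_norm_sub_le hφ hr h hz
  have hE0 : 0 ≤ E := (norm_nonneg _).trans (hloc 0 0 (by simpa using hr.le))
  refine ⟨E * (1 / r + 1), by positivity, fun z z' => ?_⟩
  have h1 := norm_sub_le_nat_mul hloc ⌈‖z - z'‖ / r⌉₊ z z'
    (by rw [← div_le_iff₀ hr]; exact Nat.le_ceil _)
  refine h1.trans ?_
  have h2 : (⌈‖z - z'‖ / r⌉₊ : ℝ) ≤ (1 / r + 1) * (‖z - z'‖ + 1) := by
    have h3 := (Nat.ceil_lt_add_one (div_nonneg (norm_nonneg (z - z')) hr.le)).le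
    have h4 : ‖z - z'‖ / r = 1 / r * ‖z - z'‖ := by ring
    have : 0 < 1 / r := by positivity
    rw [h4] at h3 ⊢
    nlinarith [norm_nonneg (z - z')]
  calc _ ≤ (1 / r + 1) * (‖z - z'‖ + 1) * E := mul_le_mul_of_nonneg_right h2 hE0
    _ = _ := by ring

end MeanOscillation

/-! ### From disks to Gaussian weights -/

/-- A Gaussian integral is controlled by the integrals over the disks of a fixed radius. -/
theorem lintegral_mul_gauss_le {g : ℂ → ENNReal} (hg : AEMeasurable g) {r s : ℝ} (hs : 0 ≤ s)
    (z : ℂ) :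
    volume (Metric.ball (0 : ℂ) r) * ∫⁻ w, g w * ENNReal.ofReal (gauss s z w) ≤
      ENNReal.ofReal (Real.exp (s * r ^ 2)) *
        ∫⁻ u, ENNReal.ofReal (gauss (s / 2) z u) * ∫⁻ w in Metric.ball u r, g w := by
  have hset : MeasurableSet {p : ℂ × ℂ | dist p.1 p.2 < r} :=
    (isOpen_lt continuous_dist continuous_const).measurableSet
  have hmg : ∀ s, Measurable fun u => ENNReal.ofReal (gauss s z u) := fun s =>
    (continuous_gauss_left s z).measurable.ennreal_ofReal
  -- The Gaussian is already recentred from `w` to `u`, so that after Tonelli the inner integral in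
  -- `w` involves `g` alone.
  set F : ℂ → ℂ → ENNReal := fun w u =>
    {p : ℂ × ℂ | dist p.1 p.2 < r}.indicator
      (fun p => g p.1 * ENNReal.ofReal (gauss (s / 2) z p.2)) (w, u) with hF
  have hFm : AEMeasurable (Function.uncurry F) (volume.prod volume) := by
    have : AEMeasurable (fun p : ℂ × ℂ => g p.1 * ENNReal.ofReal (gauss (s / 2) z p.2))
        (volume.prod volume) :=
      hg.comp_fst.mul ((hmg _).comp measurable_snd).aemeasurable
    exact this.indicator hset
  calc volume (Metric.ball (0 : ℂ) r) * ∫⁻ w, g w * ENNReal.ofReal (gauss s z w)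
      = ∫⁻ w, ∫⁻ u in Metric.ball w r, g w * ENNReal.ofReal (gauss s z w) := by
        rw [← lintegral_const_mul' _ _ measure_ball_lt_top.ne]
        refine lintegral_congr fun w => ?_
        rw [setLIntegral_const, Measure.addHaar_ball_center volume w, mul_comm]
    _ ≤ ∫⁻ w, ∫⁻ u, ENNReal.ofReal (Real.exp (s * r ^ 2)) * F w u := by
        refine lintegral_mono fun w => ?_
        rw [← lintegral_indicator measurableSet_ball]
        refine lintegral_mono fun u => ?_
        by_cases hu : u ∈ Metric.ball w r
        · have hu' : dist w u < r := by rwa [dist_comm]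
          simp only [hF, Set.indicator_of_mem hu, Set.indicator_of_mem
            (show (w, u) ∈ {p : ℂ × ℂ | dist p.1 p.2 < r} from hu')]
          rw [mul_left_comm, ← ENNReal.ofReal_mul (Real.exp_pos _).le]
          gcongr
          refine gauss_le_of_norm_sub_le hs ?_
          rw [sub_sub_sub_cancel_left, ← dist_eq_norm, dist_comm]
          exact hu'.le
        · simp [Set.indicator_of_notMem hu]
    _ = ENNReal.ofReal (Real.exp (s * r ^ 2)) * ∫⁻ w, ∫⁻ u, F w u := by
        rw [← lintegral_const_mul' _ _ ENNReal.ofReal_ne_top]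
        exact lintegral_congr fun w => lintegral_const_mul' _ _ ENNReal.ofReal_ne_top
    _ = _ := by
        rw [lintegral_lintegral_swap hFm]
        congr 1
        refine lintegral_congr fun u => ?_
        rw [← lintegral_const_mul' _ _ ENNReal.ofReal_ne_top, ← lintegral_indicator measurableSet_ball]
        refine lintegral_congr fun w => ?_
        by_cases hw : w ∈ Metric.ball u r
        · simp only [hF, Set.indicator_of_mem hw, Set.indicator_of_mem
            (show (w, u) ∈ {p : ℂ × ℂ | dist p.1 p.2 < r} from hw)]
          rw [mul_comm]
        · simp only [hF, Set.indicator_of_notMem hw, Set.indicator_of_notMem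
            (show (w, u) ∉ {p : ℂ × ℂ | dist p.1 p.2 < r} from hw)]

/-- Half of the exponent absorbs the linear factor, by `1 + x ≤ exp x`. -/
theorem add_one_mul_gauss_le {s : ℝ} (hs : 0 < s) (z u : ℂ) :
    (‖z - u‖ + 1) * gauss s z u ≤ (2 + 2 / s) * gauss (s / 2) z u := by
  have e : gauss s z u = gauss (s / 2) z u * gauss (s / 2) z u := by
    unfold gauss
    rw [← Real.exp_add]
    ring_nf
  rw [e, ← mul_assoc]
  refine mul_le_mul_of_nonneg_right ?_ (gauss_pos _ _ _).le
  set y := ‖z - u‖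
  have h1 : 1 + s / 2 * y ^ 2 ≤ Real.exp (s / 2 * y ^ 2) := by
    linarith [Real.add_one_le_exp (s / 2 * y ^ 2)]
  have h2 : gauss (s / 2) z u = (Real.exp (s / 2 * y ^ 2))⁻¹ := by
    rw [← Real.exp_neg]; rfl
  rw [h2, ← div_eq_mul_inv, div_le_iff₀ (Real.exp_pos _)]
  have h3 : y + 1 ≤ (2 + 2 / s) * (1 + s / 2 * y ^ 2) := by
    have : (2 + 2 / s) * (1 + s / 2 * y ^ 2) = 2 + 2 / s + s * y ^ 2 + y ^ 2 := by
      field_simp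
      ring
    rw [this]
    have : 0 < 2 / s := by positivity
    nlinarith [sq_nonneg (y - 1 / 2), sq_nonneg y, mul_nonneg hs.le (sq_nonneg y)]
  exact h3.trans (mul_le_mul_of_nonneg_left h1 (by positivity))

/-- For a function of bounded mean oscillation, the Gaussian mean oscillation is bounded. -/
theorem BMO.exists_gauss_oscillation_le {φ : ℂ → ℂ} (hφ : BMO φ) :
    ∃ A : ℂ → ℂ, ∀ s : ℝ, 0 < s → ∃ K : ℝ, ∀ z,
      Integrable (fun w => ‖φ w - A z‖ * gauss s z w) ∧ ∫ w, ‖φ w - A z‖ * gauss s z w ≤ K := by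
  obtain ⟨hφ, r, hr, C, hC⟩ := hφ
  -- `A` is fixed before `s`, so that Gaussian oscillations with different exponents can be compared
  -- through it.
  set A : ℂ → ℂ := fun z => ⨍ u in Metric.ball z r, φ u with hA
  refine ⟨A, fun s hs => ?_⟩
  set V := volume.real (Metric.ball (0 : ℂ) r) with hVdef
  have hV : 0 < V := volume_real_ball_pos hr
  have hosc : ∀ z, ∫ w in Metric.ball z r, ‖φ w - A z‖ ≤ V * C := fun z =>
    setIntegral_norm_sub_le hr z (A z) (hC z)
  obtain ⟨D, hD0, hD⟩ := exists_norm_average_sub_le hφ hr hosc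
  have hVC : 0 ≤ V * C := (integral_nonneg fun w => norm_nonneg _).trans (hosc 0)
  -- `V * C` comes from the oscillation of `φ` about `A u`, `V * D` from the drift between `A u` and
  -- `A z`.
  set B := V * C + V * D with hB
  have hB0 : 0 ≤ B := by positivity
  have hball : ∀ z u, ∫⁻ w in Metric.ball u r, ENNReal.ofReal ‖φ w - A z‖ ≤
      ENNReal.ofReal (B * (‖z - u‖ + 1)) := by
    intro z u
    rw [← ofReal_integral_eq_lintegral_ofReal (integrableOn_ball_norm_sub hφ u r (A z))
      (Eventually.of_forall fun w => norm_nonneg _)]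
    refine ENNReal.ofReal_le_ofReal ?_
    calc ∫ w in Metric.ball u r, ‖φ w - A z‖
        ≤ ∫ w in Metric.ball u r, (‖φ w - A u‖ + ‖A u - A z‖) :=
          setIntegral_mono (integrableOn_ball_norm_sub hφ u r _)
            ((integrableOn_ball_norm_sub hφ u r _).add (integrableOn_const measure_ball_lt_top.ne))
            fun w => norm_sub_le_norm_sub_add_norm_sub _ _ _
      _ = (∫ w in Metric.ball u r, ‖φ w - A u‖) + V * ‖A u - A z‖ := by
          rw [integral_add (integrableOn_ball_norm_sub hφ u r _)
            (integrableOn_const measure_ball_lt_top.ne), setIntegral_const, volume_real_ball,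
            smul_eq_mul]
      _ ≤ V * C + V * (D * (‖z - u‖ + 1)) := by
          have h1 := hD u z
          rw [norm_sub_rev u z] at h1
          gcongr
          exact hosc u
      _ ≤ B * (‖z - u‖ + 1) := by
          rw [hB]
          nlinarith [mul_nonneg hVC (norm_nonneg (z - u))]
  -- The exponent is halved twice: once in recentring the Gaussian, once in absorbing the linear
  -- drift.
  set G := ∫ w, gauss (s / 2 / 2) 0 w with hG
  have hG0 : 0 ≤ G := integral_nonneg fun w => (gauss_pos _ _ _).le
  set K := Real.exp (s * r ^ 2) * (B * (2 + 2 / (s / 2)) * G) / V with hK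
  have hK0 : 0 ≤ K := by positivity
  refine ⟨K, fun z => ?_⟩
  have hmeas : AEStronglyMeasurable (fun w => ‖φ w - A z‖ * gauss s z w) volume :=
    (hφ.aestronglyMeasurable.sub aestronglyMeasurable_const).norm.mul
      (continuous_gauss_left s z).aestronglyMeasurable
  have hgm : AEMeasurable fun w => ENNReal.ofReal ‖φ w - A z‖ :=
    (hφ.aestronglyMeasurable.sub aestronglyMeasurable_const).norm.aemeasurable.ennreal_ofReal
  have hnn : 0 ≤ᵐ[volume] fun w => ‖φ w - A z‖ * gauss s z w :=
    Eventually.of_forall fun w => mul_nonneg (norm_nonneg _) (gauss_pos _ _ _).le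
  have hle : ∫⁻ w, ENNReal.ofReal (‖φ w - A z‖ * gauss s z w) ≤ ENNReal.ofReal K := by
    have h1 := lintegral_mul_gauss_le hgm (r := r) hs.le z
    have h2 : ∫⁻ u, ENNReal.ofReal (gauss (s / 2) z u) *
        ∫⁻ w in Metric.ball u r, ENNReal.ofReal ‖φ w - A z‖ ≤
        ENNReal.ofReal (B * (2 + 2 / (s / 2)) * G) := by
      rw [hG, ← integral_gauss _ z, ← integral_const_mul, ofReal_integral_eq_lintegral_ofReal
        ((integrable_gauss (by positivity) z).const_mul _)
        (Eventually.of_forall fun w => mul_nonneg (by positivity) (gauss_pos _ _ _).le)]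
      refine lintegral_mono fun u => ?_
      refine (mul_le_mul_right (hball z u) _).trans ?_
      rw [← ENNReal.ofReal_mul (gauss_pos _ _ _).le]
      refine ENNReal.ofReal_le_ofReal ?_
      have := mul_le_mul_of_nonneg_left (add_one_mul_gauss_le (half_pos hs) z u) hB0
      linarith
    have hVe : volume (Metric.ball (0 : ℂ) r) = ENNReal.ofReal V :=
      (ENNReal.ofReal_toReal measure_ball_lt_top.ne).symm
    have h3 := h1.trans (mul_le_mul_right h2 _)
    rw [hVe, ← ENNReal.ofReal_mul (Real.exp_pos _).le] at h3
    have h4 : Real.exp (s * r ^ 2) * (B * (2 + 2 / (s / 2)) * G) = V * K := by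
      rw [hK]; field_simp
    rw [h4, ENNReal.ofReal_mul hV.le, ENNReal.mul_le_mul_iff_right
      (ENNReal.ofReal_pos.2 hV).ne' ENNReal.ofReal_ne_top] at h3
    refine le_trans (le_of_eq (lintegral_congr fun w => ?_)) h3
    rw [ENNReal.ofReal_mul (norm_nonneg _)]
  have hint : Integrable (fun w => ‖φ w - A z‖ * gauss s z w) :=
    ⟨hmeas, (hasFiniteIntegral_iff_ofReal hnn).2 (hle.trans_lt ENNReal.ofReal_lt_top)⟩
  refine ⟨hint, ?_⟩
  rw [← ofReal_integral_eq_lintegral_ofReal hint hnn] at hle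
  exact (ENNReal.ofReal_le_ofReal_iff hK0).1 hle

theorem BMO.aestronglyMeasurable_mul_gauss {φ : ℂ → ℂ} (hφ : BMO φ) (s : ℝ) (z : ℂ) :
    AEStronglyMeasurable (fun w => φ w * (gauss s z w : ℂ)) volume :=
  hφ.1.aestronglyMeasurable.mul
    (Complex.continuous_ofReal.comp (continuous_gauss_left s z)).aestronglyMeasurable

theorem norm_mul_gauss (φ : ℂ → ℂ) (s : ℝ) (z w : ℂ) :
    ‖φ w * (gauss s z w : ℂ)‖ = ‖φ w‖ * gauss s z w := by
  rw [norm_mul, Complex.norm_real, Real.norm_of_nonneg (gauss_pos _ _ _).le]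

theorem BMO.integrable_mul_gauss {φ : ℂ → ℂ} (hφ : BMO φ) {s : ℝ} (hs : 0 < s) (z : ℂ) :
    Integrable (fun w => φ w * (gauss s z w : ℂ)) := by
  obtain ⟨A, hA⟩ := hφ.exists_gauss_oscillation_le
  obtain ⟨K, hK⟩ := hA s hs
  refine ((hK z).1.add ((integrable_gauss hs z).const_mul ‖A z‖)).mono'
    (hφ.aestronglyMeasurable_mul_gauss s z) (Eventually.of_forall fun w => ?_)
  rw [norm_mul_gauss]
  simp only [Pi.add_apply]
  rw [← add_mul]
  refine mul_le_mul_of_nonneg_right ?_ (gauss_pos _ _ _).le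
  simpa using norm_add_le (φ w - A z) (A z)

theorem BMO.integrable_norm_mul_gauss {φ : ℂ → ℂ} (hφ : BMO φ) {s : ℝ} (hs : 0 < s) (z : ℂ) :
    Integrable (fun w => ‖φ w‖ * gauss s z w) :=
  (hφ.integrable_mul_gauss hs z).norm.congr
    (Eventually.of_forall fun w => norm_mul_gauss φ s z w)

/-- If one heat transform of a function of bounded mean oscillation is bounded, then so are all
heat transforms of its absolute value. -/
theorem BMO.exists_integral_norm_mul_gauss_le {φ : ℂ → ℂ} (hφ : BMO φ) {a M : ℝ} (ha : 0 < a)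
    (hM : ∀ z, ‖heat φ a z‖ ≤ M) {s : ℝ} (hs : 0 < s) :
    ∃ N, ∀ z, ∫ w, ‖φ w‖ * gauss s z w ≤ N := by
  obtain ⟨A, hA⟩ := hφ.exists_gauss_oscillation_le
  obtain ⟨K, hK⟩ := hA a ha
  obtain ⟨L, hL⟩ := hA s hs
  set G : ℝ → ℝ := fun s => ∫ w, gauss s 0 w with hG
  have hGa : 0 < G a := integral_gauss_pos ha 0
  have hGs : 0 < G s := integral_gauss_pos hs 0
  -- `A z * G a` differs from `heat φ a z` by the Gaussian mean of `φ - A z`, which is at most `K`.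
  have hAb : ∀ z, ‖A z‖ ≤ (K + M) / G a := by
    intro z
    rw [le_div_iff₀ hGa]
    have hi : Integrable fun w => A z * (gauss a z w : ℂ) :=
      (integrable_gauss ha z).ofReal.const_mul _
    have h1 : ∫ w, (φ w - A z) * (gauss a z w : ℂ) = heat φ a z - A z * (G a : ℂ) := by
      have : (fun w => (φ w - A z) * (gauss a z w : ℂ))
          = fun w => φ w * (gauss a z w : ℂ) - A z * (gauss a z w : ℂ) := by
        funext w; ring
      rw [this, integral_sub (hφ.integrable_mul_gauss ha z) hi, integral_const_mul, integral_complex_ofReal,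
        integral_gauss]
      rfl
    have h2 : ‖∫ w, (φ w - A z) * (gauss a z w : ℂ)‖ ≤ K := by
      refine (norm_integral_le_integral_norm _).trans (le_trans (le_of_eq ?_) (hK z).2)
      exact integral_congr_ae (Eventually.of_forall fun w => norm_mul_gauss (fun w => φ w - A z) a z w)
    have h3 : ‖A z‖ * G a = ‖A z * (G a : ℂ)‖ := by
      rw [norm_mul, Complex.norm_real, Real.norm_of_nonneg hGa.le]
    have h4 : A z * (G a : ℂ) = heat φ a z - (heat φ a z - A z * (G a : ℂ)) := by ring
    rw [h3, h4, ← h1]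
    refine (norm_sub_le _ _).trans ?_
    linarith [hM z]
  refine ⟨L + (K + M) / G a * G s, fun z => ?_⟩
  calc ∫ w, ‖φ w‖ * gauss s z w
      ≤ ∫ w, (‖φ w - A z‖ * gauss s z w + ‖A z‖ * gauss s z w) := by
        refine integral_mono (hφ.integrable_norm_mul_gauss hs z)
          ((hL z).1.add ((integrable_gauss hs z).const_mul _)) fun w => ?_
        simp only
        rw [← add_mul]
        refine mul_le_mul_of_nonneg_right ?_ (gauss_pos _ _ _).le
        simpa using norm_add_le (φ w - A z) (A z)
    _ = (∫ w, ‖φ w - A z‖ * gauss s z w) + ‖A z‖ * G s := by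
        rw [integral_add (hL z).1 ((integrable_gauss hs z).const_mul _), integral_const_mul,
          integral_gauss]
    _ ≤ _ := add_le_add (hL z).2 (mul_le_mul_of_nonneg_right (hAb z) hGs.le)

/-! ### Continuity, the semigroup law and smaller exponents -/

theorem BMO.continuous_heat {φ : ℂ → ℂ} (hφ : BMO φ) {s : ℝ} (hs : 0 < s) :
    Continuous (heat φ s) := by
  refine continuous_iff_continuousAt.2 fun z₀ => ?_
  refine tendsto_integral_filter_of_dominated_convergence
    (fun w => Real.exp (s * 1 ^ 2) * (‖φ w‖ * gauss (s / 2) z₀ w))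
    (Eventually.of_forall fun z => hφ.aestronglyMeasurable_mul_gauss s z) ?_
    ((hφ.integrable_norm_mul_gauss (half_pos hs) z₀).const_mul _) ?_
  · filter_upwards [Metric.ball_mem_nhds z₀ one_pos] with z hz
    refine Eventually.of_forall fun w => ?_
    rw [norm_mul_gauss, mul_left_comm]
    refine mul_le_mul_of_nonneg_left (gauss_le_of_norm_sub_le hs.le ?_) (norm_nonneg _)
    rw [sub_sub_sub_cancel_right, ← dist_eq_norm]
    exact (Metric.mem_ball.1 hz).le
  · refine Eventually.of_forall fun w => Continuous.tendsto ?_ _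
    have : Continuous fun z => gauss s z w := by
      unfold gauss
      fun_prop
    fun_prop

/-- Complete the square in `u`. -/
theorem gauss_mul_gauss {a c : ℝ} (ha : 0 < a) (hc : 0 < c) (z w u : ℂ) :
    gauss a u w * gauss c z u =
      gauss (a * c / (a + c)) z w * gauss (a + c) ((a * w + c * z) / (a + c)) u := by
  unfold gauss
  rw [← Real.exp_add, ← Real.exp_add]
  congr 1
  have hn : ∀ x : ℂ, ‖x‖ ^ 2 = x.re ^ 2 + x.im ^ 2 := fun x => by
    rw [← Complex.normSq_eq_norm_sq, Complex.normSq_apply]; ring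
  have hd : (a * w + c * z) / (a + c) = (((a + c)⁻¹ : ℝ) : ℂ) * (a * w + c * z) := by
    push_cast; rw [div_eq_inv_mul]
  have : a + c ≠ 0 := (add_pos ha hc).ne'
  rw [hd, hn, hn, hn, hn]
  simp only [Complex.sub_re, Complex.sub_im, Complex.re_ofReal_mul, Complex.im_ofReal_mul,
    Complex.add_re, Complex.add_im]
  field_simp
  ring

/-- The semigroup property of the heat transform. -/
theorem BMO.heat_eq_integral {φ : ℂ → ℂ} (hφ : BMO φ) {a c : ℝ} (ha : 0 < a) (hc : 0 < c) (z : ℂ) :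
    ((∫ u, gauss (a + c) 0 u : ℝ) : ℂ) * heat φ (a * c / (a + c)) z =
      ∫ u, heat φ a (z - u) * (gauss c 0 u : ℂ) := by
  have hac : 0 < a + c := add_pos ha hc
  set G : ℝ := ∫ u, gauss (a + c) 0 u with hG
  have key : ∀ w, ∫ u, gauss a u w * gauss c z u = G * gauss (a * c / (a + c)) z w := by
    intro w
    simp_rw [gauss_mul_gauss ha hc]
    rw [integral_const_mul, integral_gauss, mul_comm]
  have hki : ∀ w, Integrable fun u => gauss a u w * gauss c z u := by
    intro w
    simp_rw [gauss_mul_gauss ha hc]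
    exact (integrable_gauss hac _).const_mul _
  set F : ℂ → ℂ → ℂ := fun w u => φ w * ((gauss a u w * gauss c z u : ℝ) : ℂ) with hF
  have hnF : ∀ w u, ‖F w u‖ = ‖φ w‖ * (gauss a u w * gauss c z u) := by
    intro w u
    simp only [hF]
    rw [norm_mul, Complex.norm_real,
      Real.norm_of_nonneg (mul_nonneg (gauss_pos _ _ _).le (gauss_pos _ _ _).le)]
  have hint : Integrable (Function.uncurry F) (volume.prod volume) := by
    have hm : AEStronglyMeasurable (Function.uncurry F) (volume.prod volume) := by
      refine hφ.1.aestronglyMeasurable.comp_fst.mul (Continuous.aestronglyMeasurable ?_)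
      have h1 := (continuous_gauss a).comp (continuous_swap (X := ℂ) (Y := ℂ))
      have h2 := (continuous_gauss_left c z).comp (continuous_snd (X := ℂ) (Y := ℂ))
      exact Complex.continuous_ofReal.comp (h1.mul h2)
    refine (integrable_prod_iff hm).2 ⟨Eventually.of_forall fun w => ?_, ?_⟩
    · exact (Integrable.ofReal (𝕜 := ℂ) (hki w)).const_mul (φ w)
    · have := (hφ.integrable_norm_mul_gauss (s := a * c / (a + c)) (by positivity) z).const_mul G
      refine this.congr (Eventually.of_forall fun w => ?_)
      simp only [Function.uncurry_apply_pair, hnF]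
      rw [integral_const_mul, key]
      ring
  have hswap := integral_integral_swap hint
  have hl : ∫ w, ∫ u, F w u = (G : ℂ) * heat φ (a * c / (a + c)) z := by
    unfold heat
    rw [← integral_const_mul]
    refine integral_congr_ae (Eventually.of_forall fun w => ?_)
    simp only [hF]
    rw [integral_const_mul, integral_complex_ofReal, key]
    push_cast
    ring
  rw [← hl, hswap, ← integral_sub_left_eq_self (fun u => ∫ w, F w u) volume z]
  refine integral_congr_ae (Eventually.of_forall fun u => ?_)
  simp only [hF, heat]
  rw [← integral_mul_const]
  refine integral_congr_ae (Eventually.of_forall fun w => ?_)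
  have : gauss c z (z - u) = gauss c 0 u := by simp [gauss]
  simp only [this]
  push_cast
  ring

theorem BMO.tendsto_heat_of_le {φ : ℂ → ℂ} (hφ : BMO φ) {a M : ℝ} (ha : 0 < a)
    (hM : ∀ z, ‖heat φ a z‖ ≤ M) (h : Tendsto (heat φ a) (cocompact ℂ) (𝓝 0)) {s : ℝ} (hs : 0 < s)
    (hsa : s ≤ a) : Tendsto (heat φ s) (cocompact ℂ) (𝓝 0) := by
  rcases hsa.eq_or_lt with rfl | hsa
  · exact h
  have hd : 0 < a - s := sub_pos.2 hsa
  -- The solution of `1 / s = 1 / a + 1 / c`, since reciprocals of exponents add under convolution.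
  set c := a * s / (a - s) with hc
  have hc0 : 0 < c := by positivity
  have hse : a * c / (a + c) = s := by
    rw [hc]; field_simp; ring
  have hG := integral_gauss_pos (add_pos ha hc0) 0
  have e : heat φ s = fun z => ((∫ u, gauss (a + c) 0 u : ℝ) : ℂ)⁻¹ *
      ∫ u, heat φ a (z - u) * (gauss c 0 u : ℂ) := by
    funext z
    rw [← hφ.heat_eq_integral ha hc0, hse, inv_mul_cancel_left₀]
    exact_mod_cast hG.ne'
  rw [e]
  suffices hlim : Tendsto (fun z => ∫ u, heat φ a (z - u) * (gauss c 0 u : ℂ)) (cocompact ℂ)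
      (𝓝 0) by
    simpa using hlim.const_mul (((∫ u, gauss (a + c) 0 u : ℝ) : ℂ)⁻¹)
  have h0 : (0 : ℂ) = ∫ _u : ℂ, (0 : ℂ) := by simp
  rw [show 𝓝 (0 : ℂ) = 𝓝 (∫ _u : ℂ, (0 : ℂ)) by rw [← h0]]
  refine tendsto_integral_filter_of_dominated_convergence (fun u => M * gauss c 0 u)
    (Eventually.of_forall fun z => ?_) (Eventually.of_forall fun z => Eventually.of_forall fun u => ?_)
    ((integrable_gauss hc0 0).const_mul _) (Eventually.of_forall fun u => ?_)
  · refine Continuous.aestronglyMeasurable ?_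
    exact ((hφ.continuous_heat ha).comp (continuous_const.sub continuous_id)).mul
      (Complex.continuous_ofReal.comp (continuous_gauss_left c 0))
  · rw [norm_mul, Complex.norm_real, Real.norm_of_nonneg (gauss_pos _ _ _).le]
    exact mul_le_mul_of_nonneg_right (hM _) (gauss_pos _ _ _).le
  · have h1 : Tendsto (fun z : ℂ => z - u) (cocompact ℂ) (cocompact ℂ) :=
      (Homeomorph.subRight u).isClosedEmbedding.tendsto_cocompact
    simpa using (h.comp h1).mul_const (gauss c 0 u : ℂ)

/-! ### Polynomial approximation and larger exponents -/

/-- The truncated binomial expansion of `x ^ (4 j)` about `1 / 2`. -/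
theorem abs_pow_sub_sum_le {x : ℝ} (h0 : 0 ≤ x) (h1 : x ≤ 1) (j : ℕ) :
    |x ^ (4 * j) - ∑ k ∈ Finset.range (3 * j + 1),
      (x - 1 / 2) ^ k * (1 / 2) ^ (4 * j - k) * ((4 * j).choose k : ℝ)| ≤ (81 / 128) ^ j := by
  have e : x ^ (4 * j) = ∑ k ∈ Finset.range (4 * j + 1),
      (x - 1 / 2) ^ k * (1 / 2) ^ (4 * j - k) * ((4 * j).choose k : ℝ) := by
    rw [← add_pow]; norm_num
  have hsub : Finset.range (3 * j + 1) ⊆ Finset.range (4 * j + 1) :=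
    Finset.range_subset_range.2 (by omega)
  rw [e, ← Finset.sum_sdiff hsub, add_sub_cancel_right]
  refine (Finset.abs_sum_le_sum_abs _ _).trans ?_
  have hx : |x - 1 / 2| ≤ 1 / 2 := abs_le.2 ⟨by linarith, by linarith⟩
  -- A Chernoff bound: in the tail `k > 3 j`, so a factor `2 ^ (k - 3 j) ≥ 1` may be inserted. The
  -- full sum of `2 ^ k` times binomials is `3 ^ (4 j)`, and `3 ^ 4 / 2 ^ 7 = 81 / 128`.
  calc _ ≤ ∑ k ∈ Finset.range (4 * j + 1) \ Finset.range (3 * j + 1),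
        (1 / 2) ^ (7 * j) * (2 ^ k * 1 ^ (4 * j - k) * ((4 * j).choose k : ℝ)) := by
        refine Finset.sum_le_sum fun k hk => ?_
        simp only [Finset.mem_sdiff, Finset.mem_range, not_lt] at hk
        rw [abs_mul, abs_mul, abs_pow, abs_pow, Nat.abs_cast, one_pow, mul_one, ← mul_assoc]
        refine mul_le_mul_of_nonneg_right ?_ (Nat.cast_nonneg _)
        rw [abs_of_pos (by norm_num : (0 : ℝ) < 1 / 2)]
        calc |x - 1 / 2| ^ k * (1 / 2) ^ (4 * j - k) ≤ (1 / 2) ^ k * (1 / 2) ^ (4 * j - k) := by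
              gcongr
          _ = (1 / 2) ^ (4 * j) := by rw [← pow_add]; congr 1; omega
          _ = (1 / 2) ^ (7 * j) * 2 ^ (3 * j) := by
              rw [show 7 * j = 4 * j + 3 * j by ring, pow_add, mul_assoc, ← mul_pow]; norm_num
          _ ≤ (1 / 2) ^ (7 * j) * 2 ^ k := by
              gcongr
              · norm_num
              · omega
    _ ≤ ∑ k ∈ Finset.range (4 * j + 1),
        (1 / 2) ^ (7 * j) * (2 ^ k * 1 ^ (4 * j - k) * ((4 * j).choose k : ℝ)) :=
        Finset.sum_le_sum_of_subset_of_nonneg Finset.sdiff_subset fun _ _ _ => by positivity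
    _ = (81 / 128) ^ j := by
        rw [← Finset.mul_sum, ← add_pow, pow_mul, pow_mul, ← mul_pow]; norm_num

/-- `x ^ (4 j)` is within `(81 / 128) ^ j` of a polynomial of degree at most `3 j` on `[0, 1]`. -/
theorem exists_polynomial_abs_pow_sub_le (j : ℕ) : ∃ p : Polynomial ℝ, p.natDegree ≤ 3 * j ∧
    ∀ x : ℝ, 0 ≤ x → x ≤ 1 → |x ^ (4 * j) - p.eval x| ≤ (81 / 128) ^ j := by
  refine ⟨∑ k ∈ Finset.range (3 * j + 1), (Polynomial.X - Polynomial.C (1 / 2)) ^ k *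
    Polynomial.C ((1 / 2) ^ (4 * j - k) * ((4 * j).choose k : ℝ)), ?_, fun x h0 h1 => ?_⟩
  · refine Polynomial.natDegree_sum_le_of_forall_le _ _ fun k hk => ?_
    refine (Polynomial.natDegree_mul_C_le _ _).trans (Polynomial.natDegree_pow_le.trans ?_)
    rw [Polynomial.natDegree_X_sub_C, mul_one]
    have := Finset.mem_range.1 hk
    omega
  · have h := abs_pow_sub_sum_le h0 h1 j
    rw [Polynomial.eval_finsetSum]
    simpa [mul_assoc] using h

theorem gauss_add_nat_mul (b d : ℝ) (k : ℕ) (z w : ℂ) :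
    gauss (b + k * d) z w = gauss b z w * gauss d z w ^ k := by
  unfold gauss
  rw [← Real.exp_nat_mul, ← Real.exp_add]
  congr 1
  ring

theorem gauss_le_one {s : ℝ} (hs : 0 ≤ s) (z w : ℂ) : gauss s z w ≤ 1 :=
  Real.exp_le_one_iff.2 (by have : 0 ≤ s * ‖z - w‖ ^ 2 := by positivity
                            linarith)

/-- Powers of a Gaussian are Gaussians, so a polynomial in one turns into a finite combination of
heat transforms. -/
theorem BMO.integral_mul_gauss_mul_eval {φ : ℂ → ℂ} (hφ : BMO φ) {b d : ℝ} (hb : 0 < b)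
    (hd : 0 ≤ d) (p : Polynomial ℝ) (z : ℂ) :
    Integrable (fun w => φ w * ((gauss b z w * p.eval (gauss d z w) : ℝ) : ℂ)) ∧
    ∫ w, φ w * ((gauss b z w * p.eval (gauss d z w) : ℝ) : ℂ) =
      ∑ k ∈ Finset.range (p.natDegree + 1), (p.coeff k : ℂ) * heat φ (b + k * d) z := by
  have e : (fun w => φ w * ((gauss b z w * p.eval (gauss d z w) : ℝ) : ℂ)) = fun w =>
      ∑ k ∈ Finset.range (p.natDegree + 1),
        (p.coeff k : ℂ) * (φ w * (gauss (b + k * d) z w : ℂ)) := by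
    funext w
    rw [Polynomial.eval_eq_sum_range, Finset.mul_sum, Complex.ofReal_sum, Finset.mul_sum]
    refine Finset.sum_congr rfl fun k _ => ?_
    rw [gauss_add_nat_mul]
    push_cast
    ring
  have hi : ∀ k ∈ Finset.range (p.natDegree + 1),
      Integrable fun w => (p.coeff k : ℂ) * (φ w * (gauss (b + k * d) z w : ℂ)) := fun k _ =>
    (hφ.integrable_mul_gauss (by positivity) z).const_mul _
  rw [e]
  refine ⟨integrable_finsetSum _ hi, ?_⟩
  rw [integral_finsetSum _ hi]
  exact Finset.sum_congr rfl fun k _ => integral_const_mul _ _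

/-- With `x = gauss d z w`, the target Gaussian is `gauss (s / 9)` times `x ^ (4 j)`. Replacing this
power by a polynomial of degree at most `3 j` uses only exponents up to `7 s / 9`, with an error at
most `(81 / 128) ^ j * N` uniformly in `z`. -/
theorem BMO.tendsto_heat_of_forall_le {φ : ℂ → ℂ} (hφ : BMO φ) {s N : ℝ} (hs : 0 < s)
    (hN : ∀ z, ∫ w, ‖φ w‖ * gauss (s / 9) z w ≤ N)
    (h : ∀ σ, 0 < σ → σ ≤ 7 / 9 * s → Tendsto (heat φ σ) (cocompact ℂ) (𝓝 0)) :
    Tendsto (heat φ s) (cocompact ℂ) (𝓝 0) := by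
  have hN0 : 0 ≤ N := (integral_nonneg fun w =>
    mul_nonneg (norm_nonneg _) (gauss_pos _ _ _).le).trans (hN 0)
  rw [Metric.tendsto_nhds]
  intro ε hε
  obtain ⟨j, hj0, hj⟩ : ∃ j : ℕ, 0 < j ∧ (81 / 128 : ℝ) ^ j * N < ε / 2 := by
    have ht : Tendsto (fun j : ℕ => (81 / 128 : ℝ) ^ j * N) atTop (𝓝 (0 * N)) :=
      (tendsto_pow_atTop_nhds_zero_of_lt_one (by norm_num) (by norm_num)).mul_const N
    rw [zero_mul] at ht
    exact ((eventually_gt_atTop 0).and (ht.eventually (gt_mem_nhds (half_pos hε)))).exists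
  have hj0' : (0 : ℝ) < j := by exact_mod_cast hj0
  obtain ⟨p, hp, hpx⟩ := exists_polynomial_abs_pow_sub_le j
  -- Chosen so that `s / 9 + 4 j d = s` and `s / 9 + 3 j d = 7 s / 9`.
  set d : ℝ := 2 * s / (9 * j) with hd
  have hd0 : 0 < d := by positivity
  have hb : 0 < s / 9 := by positivity
  have hdj : (j : ℝ) * d = 2 / 9 * s := by rw [hd]; field_simp
  set S : ℂ → ℂ := fun z => ∑ k ∈ Finset.range (p.natDegree + 1),
    (p.coeff k : ℂ) * heat φ (s / 9 + k * d) z with hS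
  have hSt : Tendsto S (cocompact ℂ) (𝓝 0) := by
    have : Tendsto S (cocompact ℂ)
        (𝓝 (∑ k ∈ Finset.range (p.natDegree + 1), (p.coeff k : ℂ) * 0)) := by
      refine tendsto_finsetSum _ fun k hk => (h _ (by positivity) ?_).const_mul _
      have hk' : (k : ℝ) ≤ 3 * j := by
        have := Finset.mem_range.1 hk
        exact_mod_cast (show k ≤ 3 * j by omega)
      have := mul_le_mul_of_nonneg_right hk' hd0.le
      linarith
    simpa using this
  have hdiff : ∀ z, ‖heat φ s z - S z‖ ≤ (81 / 128) ^ j * N := by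
    intro z
    obtain ⟨hi, he⟩ := hφ.integral_mul_gauss_mul_eval hb hd0.le p z
    have hse : s = s / 9 + (4 * j : ℕ) * d := by
      push_cast; linarith
    rw [show S z = _ from he.symm, heat, ← integral_sub (hφ.integrable_mul_gauss hs z) hi]
    refine (norm_integral_le_integral_norm _).trans ?_
    refine le_trans ?_ (mul_le_mul_of_nonneg_left (hN z) (by positivity))
    rw [← integral_const_mul]
    refine integral_mono ((hφ.integrable_mul_gauss hs z).sub hi).norm
      ((hφ.integrable_norm_mul_gauss hb z).const_mul _) fun w => ?_
    have h1 : φ w * (gauss s z w : ℂ) -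
        φ w * ((gauss (s / 9) z w * p.eval (gauss d z w) : ℝ) : ℂ) =
        φ w * ((gauss (s / 9) z w * (gauss d z w ^ (4 * j) - p.eval (gauss d z w)) : ℝ) : ℂ) := by
      have : gauss s z w = gauss (s / 9) z w * gauss d z w ^ (4 * j) := by
        conv_lhs => rw [hse]
        exact gauss_add_nat_mul _ _ _ _ _
      rw [this]
      push_cast
      ring
    simp only [h1]
    rw [norm_mul, Complex.norm_real, Real.norm_eq_abs, abs_mul, abs_of_pos (gauss_pos _ _ _),
      ← mul_assoc, mul_comm]
    exact mul_le_mul_of_nonneg_right (hpx _ (gauss_pos _ _ _).le (gauss_le_one hd0.le _ _))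
      (mul_nonneg (norm_nonneg _) (gauss_pos _ _ _).le)
  filter_upwards [(Metric.tendsto_nhds.1 hSt) (ε / 2) (half_pos hε)] with z hz
  rw [dist_zero_right] at hz ⊢
  have : ‖heat φ s z‖ ≤ ‖heat φ s z - S z‖ + ‖S z‖ := by
    simpa using norm_add_le (heat φ s z - S z) (S z)
  linarith [hdiff z]

/-- If one heat transform of a function of bounded mean oscillation is bounded and vanishes at
infinity, then all of them vanish at infinity. -/
theorem BMO.tendsto_heat {φ : ℂ → ℂ} (hφ : BMO φ) {a M : ℝ} (ha : 0 < a)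
    (hM : ∀ z, ‖heat φ a z‖ ≤ M) (h : Tendsto (heat φ a) (cocompact ℂ) (𝓝 0)) {s : ℝ} (hs : 0 < s) :
    Tendsto (heat φ s) (cocompact ℂ) (𝓝 0) := by
  have key : ∀ n : ℕ, ∀ σ, 0 < σ → σ ≤ (9 / 7) ^ n * a →
      Tendsto (heat φ σ) (cocompact ℂ) (𝓝 0) := by
    intro n
    induction n with
    | zero => exact fun σ h0 h1 => hφ.tendsto_heat_of_le ha hM h h0 (by simpa using h1)
    | succ n ih =>
      intro σ h0 h1
      obtain ⟨N, hN⟩ := hφ.exists_integral_norm_mul_gauss_le ha hM (s := σ / 9) (by positivity)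
      refine hφ.tendsto_heat_of_forall_le h0 hN fun τ t0 t1 => ih τ t0 (t1.trans ?_)
      rw [pow_succ] at h1
      linarith
  obtain ⟨n, hn⟩ := pow_unbounded_of_one_lt (s / a) (show (1 : ℝ) < 9 / 7 by norm_num)
  exact key n s hs ((div_lt_iff₀ ha).1 hn).le

/-! ### Point evaluations and normalized kernels -/

theorem norm_weighted_le (α : ℝ) (f : FInfty α) (z : ℂ) : ‖weighted α f z‖ ≤ ‖f‖ := by
  have hc : Continuous (weighted α f) := by
    have hk : Continuous f.1 := f.2.1.continuous
    unfold weighted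
    fun_prop
  have hae : ∀ᵐ w, ‖weighted α f w‖ ≤ ‖f‖ := by
    filter_upwards [ae_le_eLpNormEssSup (f := weighted α f) (μ := volume)] with w hw
    rw [FInfty.norm_def, eLpNorm_exponent_top, ← toReal_enorm]
    refine ENNReal.toReal_mono ?_ hw
    have := f.2.2.eLpNorm_lt_top.ne
    rwa [eLpNorm_exponent_top] at this
  have hcl : IsClosed {w | ‖weighted α f w‖ ≤ ‖f‖} := isClosed_le hc.norm continuous_const
  -- A set of full measure is dense, and this one is closed, so the essential bound holds at every
  -- point.
  have := hcl.closure_eq ▸ (Measure.dense_of_ae hae).closure_eq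
  exact (this ▸ Set.mem_univ z : z ∈ {w | ‖weighted α f w‖ ≤ ‖f‖})

theorem norm_apply_le (α : ℝ) (f : FInfty α) (z : ℂ) :
    ‖f z‖ ≤ Real.exp (α * ‖z‖ ^ 2 / 2) * ‖f‖ := by
  have h := norm_weighted_le α f z
  rw [weighted, norm_mul, Complex.norm_real, Real.norm_of_nonneg (Real.exp_pos _).le,
    Real.exp_neg, ← div_eq_mul_inv, div_le_iff₀ (Real.exp_pos _)] at h
  linarith

theorem continuous_apply (α : ℝ) (z : ℂ) : Continuous fun f : FInfty α => f z :=
  AddMonoidHomClass.continuous_of_bound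
    (AddMonoidHom.mk' (fun f : FInfty α => f z) fun _ _ => rfl) _ fun f => norm_apply_le α f z

theorem norm_kernel (α : ℝ) (z w : ℂ) :
    ‖kernel α z w‖ =
      Real.exp (α * ‖z‖ ^ 2 / 2) * Real.exp (α * ‖w‖ ^ 2 / 2) * gauss (α / 2) z w := by
  unfold kernel gauss
  rw [Complex.norm_exp, ← Real.exp_add, ← Real.exp_add]
  congr 1
  have hn : ∀ x : ℂ, ‖x‖ ^ 2 = x.re ^ 2 + x.im ^ 2 := fun x => by
    rw [← Complex.normSq_eq_norm_sq, Complex.normSq_apply]; ring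
  rw [hn, hn, hn]
  simp
  ring

/-- The normalized reproducing kernel. -/
def unitKernelFun (α : ℝ) (z w : ℂ) : ℂ := kernel α z w * (Real.exp (-(α * ‖z‖ ^ 2 / 2)) : ℂ)

theorem norm_unitKernelFun (α : ℝ) (z w : ℂ) :
    ‖unitKernelFun α z w‖ = Real.exp (α * ‖w‖ ^ 2 / 2) * gauss (α / 2) z w := by
  have h := (Real.exp_pos (α * ‖z‖ ^ 2 / 2)).ne'
  rw [unitKernelFun, norm_mul, norm_kernel, Complex.norm_real,
    Real.norm_of_nonneg (Real.exp_pos _).le, Real.exp_neg]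
  field_simp

theorem norm_weighted_unitKernelFun (α : ℝ) (z w : ℂ) :
    ‖weighted α (unitKernelFun α z) w‖ = gauss (α / 2) z w := by
  have h := (Real.exp_pos (α * ‖w‖ ^ 2 / 2)).ne'
  rw [weighted, norm_mul, norm_unitKernelFun, Complex.norm_real,
    Real.norm_of_nonneg (Real.exp_pos _).le, Real.exp_neg]
  field_simp

theorem differentiable_unitKernelFun (α : ℝ) (z : ℂ) : Differentiable ℂ (unitKernelFun α z) := by
  unfold unitKernelFun kernel
  fun_prop

theorem continuous_weighted_unitKernelFun (α : ℝ) (z : ℂ) :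
    Continuous (weighted α (unitKernelFun α z)) := by
  have := (differentiable_unitKernelFun α z).continuous
  unfold weighted
  fun_prop

theorem unitKernelFun_mem {α : ℝ} (hα : 0 ≤ α) (z : ℂ) : unitKernelFun α z ∈ inftySubmodule α :=
  ⟨differentiable_unitKernelFun α z,
    memLp_top_of_bound (continuous_weighted_unitKernelFun α z).aestronglyMeasurable 1
      (Eventually.of_forall fun w => by
        rw [norm_weighted_unitKernelFun]
        exact gauss_le_one (by positivity) z w)⟩

/-- The normalized reproducing kernel as an element of `F^∞_α`. -/
def unitKernel {α : ℝ} (hα : 0 ≤ α) (z : ℂ) : FInfty α :=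
  (⟨unitKernelFun α z, unitKernelFun_mem hα z⟩ : inftySubmodule α)

theorem norm_unitKernel_le {α : ℝ} (hα : 0 ≤ α) (z : ℂ) : ‖unitKernel hα z‖ ≤ 1 := by
  rw [FInfty.norm_def, eLpNorm_exponent_top]
  refine ENNReal.toReal_le_of_le_ofReal zero_le_one ?_
  refine eLpNormEssSup_le_of_ae_bound (Eventually.of_forall fun w => ?_)
  rw [show weighted α (unitKernel hα z) = weighted α (unitKernelFun α z) from rfl,
    norm_weighted_unitKernelFun]
  exact gauss_le_one (by positivity) z w

/-! ### Toeplitz images of kernels and compactness -/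

theorem toeplitz_eq_integral {α : ℝ} (hα : 0 ≤ α) (φ f : ℂ → ℂ) (z : ℂ) :
    toeplitz α φ f z = ∫ w, ((α / Real.pi * Real.exp (-(α * ‖w‖ ^ 2)) : ℝ) : ℂ) *
      (φ w * f w * conj (kernel α z w)) := by
  unfold toeplitz gaussian
  rw [integral_withDensity_eq_integral_toReal_smul (by fun_prop)
    (Eventually.of_forall fun w => ENNReal.ofReal_lt_top)]
  refine integral_congr_ae (Eventually.of_forall fun w => ?_)
  simp only
  rw [ENNReal.toReal_ofReal (by have := Real.pi_pos; positivity), Complex.real_smul]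

theorem toeplitz_unitKernelFun_self {α : ℝ} (hα : 0 ≤ α) (φ : ℂ → ℂ) (z : ℂ) :
    toeplitz α φ (unitKernelFun α z) z =
      ((α / Real.pi * Real.exp (α * ‖z‖ ^ 2 / 2) : ℝ) : ℂ) * heat φ α z := by
  rw [toeplitz_eq_integral hα, heat, ← integral_const_mul]
  refine integral_congr_ae (Eventually.of_forall fun w => ?_)
  have h1 : kernel α z w * conj (kernel α z w) = ((‖kernel α z w‖ ^ 2 : ℝ) : ℂ) := by
    rw [Complex.mul_conj, Complex.normSq_eq_norm_sq]
  have h2 : Real.exp (-(α * ‖w‖ ^ 2)) * (‖kernel α z w‖ ^ 2 * Real.exp (-(α * ‖z‖ ^ 2 / 2))) =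
      Real.exp (α * ‖z‖ ^ 2 / 2) * gauss α z w := by
    rw [norm_kernel]
    unfold gauss
    rw [← Real.exp_add, ← Real.exp_add, ← Real.exp_nat_mul, ← Real.exp_add, ← Real.exp_add,
      ← Real.exp_add]
    congr 1
    push_cast
    ring
  simp only [unitKernelFun]
  calc _ = ((α / Real.pi : ℝ) : ℂ) * φ w * ((Real.exp (-(α * ‖w‖ ^ 2)) : ℝ) *
        ((kernel α z w * conj (kernel α z w)) * (Real.exp (-(α * ‖z‖ ^ 2 / 2)) : ℝ))) := by
        push_cast; ring
    _ = ((α / Real.pi : ℝ) : ℂ) * φ w * ((Real.exp (-(α * ‖w‖ ^ 2)) *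
        (‖kernel α z w‖ ^ 2 * Real.exp (-(α * ‖z‖ ^ 2 / 2))) : ℝ) : ℂ) := by
        rw [h1]; push_cast; ring
    _ = _ := by rw [h2]; push_cast; ring

theorem tendsto_gauss_cocompact {s : ℝ} (hs : 0 < s) (w : ℂ) :
    Tendsto (fun z => gauss s z w) (cocompact ℂ) (𝓝 0) := by
  have h1 : Tendsto (fun z : ℂ => z - w) (cocompact ℂ) (cocompact ℂ) :=
    (Homeomorph.subRight w).isClosedEmbedding.tendsto_cocompact
  have h2 : Tendsto (fun z : ℂ => ‖z - w‖) (cocompact ℂ) atTop :=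
    (tendsto_norm_cocompact_atTop (E := ℂ)).comp h1
  have h3 := ((tendsto_pow_atTop (two_ne_zero)).comp h2).const_mul_atTop hs
  exact Real.tendsto_exp_neg_atTop_nhds_zero.comp h3

/-- The Toeplitz images of the normalized kernels tend to zero pointwise. -/
theorem BMO.tendsto_toeplitz_unitKernelFun {φ : ℂ → ℂ} (hφ : BMO φ) {α : ℝ} (hα : 0 < α) (ζ : ℂ) :
    Tendsto (fun z => toeplitz α φ (unitKernelFun α z) ζ) (cocompact ℂ) (𝓝 0) := by
  have hpi := Real.pi_pos
  set c := α / Real.pi * Real.exp (α * ‖ζ‖ ^ 2 / 2) with hc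
  have hc0 : 0 ≤ c := by positivity
  -- The growth of the two kernels in `w` cancels the Gaussian density. What depends on `z` is a
  -- factor at most `1` that tends to zero; the rest is the integrable dominating function.
  have hnorm : ∀ z w, ‖((α / Real.pi * Real.exp (-(α * ‖w‖ ^ 2)) : ℝ) : ℂ) *
      (φ w * unitKernelFun α z w * conj (kernel α ζ w))‖ =
      c * (‖φ w‖ * gauss (α / 2) ζ w) * gauss (α / 2) z w := by
    intro z w
    rw [norm_mul, norm_mul, norm_mul, RCLike.norm_conj, norm_unitKernelFun, norm_kernel,
      Complex.norm_real, Real.norm_of_nonneg (by positivity), hc]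
    have : Real.exp (-(α * ‖w‖ ^ 2)) * Real.exp (α * ‖w‖ ^ 2 / 2) *
        Real.exp (α * ‖w‖ ^ 2 / 2) = 1 := by
      rw [← Real.exp_add, ← Real.exp_add, Real.exp_eq_one_iff]
      ring
    linear_combination (α / Real.pi * Real.exp (α * ‖ζ‖ ^ 2 / 2) *
      (‖φ w‖ * gauss (α / 2) ζ w) * gauss (α / 2) z w) * this
  have h0 : (0 : ℂ) = ∫ _u : ℂ, (0 : ℂ) := by simp
  simp_rw [toeplitz_eq_integral hα.le]
  rw [h0]
  refine tendsto_integral_filter_of_dominated_convergence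
    (fun w => c * (‖φ w‖ * gauss (α / 2) ζ w)) (Eventually.of_forall fun z => ?_)
    (Eventually.of_forall fun z => Eventually.of_forall fun w => ?_)
    ((hφ.integrable_norm_mul_gauss (half_pos hα) ζ).const_mul c)
    (Eventually.of_forall fun w => ?_)
  · have hk : Continuous fun w => conj (kernel α ζ w) := by
      unfold kernel
      fun_prop
    have hd : Continuous fun w : ℂ => ((α / Real.pi * Real.exp (-(α * ‖w‖ ^ 2)) : ℝ) : ℂ) := by
      fun_prop
    exact hd.aestronglyMeasurable.mul ((hφ.1.aestronglyMeasurable.mul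
      (differentiable_unitKernelFun α z).continuous.aestronglyMeasurable).mul
        hk.aestronglyMeasurable)
  · rw [hnorm]
    exact mul_le_of_le_one_right
      (mul_nonneg hc0 (mul_nonneg (norm_nonneg _) (gauss_pos _ _ _).le))
      (gauss_le_one (half_pos hα).le _ _)
  · rw [tendsto_zero_iff_norm_tendsto_zero]
    simp_rw [hnorm]
    simpa using (tendsto_gauss_cocompact (half_pos hα) w).const_mul
      (c * (‖φ w‖ * gauss (α / 2) ζ w))

theorem norm_heat_le {α : ℝ} (hα : 0 < α) {φ : ℂ → ℂ} {T : FInfty α →L[ℂ] FInfty α}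
    (hT : ∀ (f : FInfty α) (z : ℂ), T f z = toeplitz α φ f z) (z : ℂ) :
    ‖heat φ α z‖ ≤ Real.pi / α * ‖T (unitKernel hα.le z)‖ := by
  have hpi := Real.pi_pos
  have h := norm_apply_le α (T (unitKernel hα.le z)) z
  have he := Real.exp_pos (α * ‖z‖ ^ 2 / 2)
  rw [hT, show toeplitz α φ (unitKernel hα.le z) z = toeplitz α φ (unitKernelFun α z) z from rfl,
    toeplitz_unitKernelFun_self hα.le, norm_mul, Complex.norm_real,
    Real.norm_of_nonneg (by positivity), mul_right_comm, mul_comm, mul_le_mul_iff_right₀ he] at h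
  rw [div_mul_eq_mul_div, le_div_iff₀ hα]
  rw [div_mul_eq_mul_div, div_le_iff₀ hpi] at h
  linarith

/-- The images stay in a compact set, and evaluations are continuous, so pointwise decay forces
every cluster point to be zero; hence the convergence is in norm. -/
theorem tendsto_map_unitKernel {α : ℝ} (hα : 0 < α) {φ : ℂ → ℂ} (hφ : BMO φ)
    {T : FInfty α →L[ℂ] FInfty α} (hT : ∀ (f : FInfty α) (z : ℂ), T f z = toeplitz α φ f z)
    (hc : IsCompactOperator T) :
    Tendsto (fun z => T (unitKernel hα.le z)) (cocompact ℂ) (𝓝 0) := by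
  obtain ⟨K, hK, hTK⟩ := IsCompactOperator.image_closedBall_subset_compact
    (f := (T : FInfty α →ₗ[ℂ] FInfty α)) hc 1
  refine hK.tendsto_nhds_of_unique_mapClusterPt (Eventually.of_forall fun z => hTK ⟨_, ?_, rfl⟩) ?_
  · simpa using norm_unitKernel_le hα.le z
  · intro f _ hf
    refine Subtype.ext (funext fun ζ => ?_)
    have h1 : MapClusterPt (f ζ) (cocompact ℂ) fun z => T (unitKernel hα.le z) ζ :=
      hf.continuousAt_comp (continuous_apply α ζ).continuousAt
    have h2 : Tendsto (fun z => T (unitKernel hα.le z) ζ) (cocompact ℂ) (𝓝 0) := by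
      simp_rw [hT]
      exact hφ.tendsto_toeplitz_unitKernelFun hα ζ
    exact eq_of_nhds_neBot (h1.clusterPt.mono h2)

end Fock

end

theorem theorem4p6 (α : ℝ) (hα : 0 < α) (φ : ℂ → ℂ) (hφ : Fock.BMO φ)
    (hT : Fock.IsCompactToeplitz α φ) (t : ℝ) (ht : 0 < t) :
    (∀ z : ℂ, MeasureTheory.Integrable (Fock.berezinIntegrand α t φ z) MeasureTheory.volume) ∧
      ∃ g : ZeroAtInftyContinuousMap ℂ ℂ, ∀ z : ℂ, g z = Fock.berezin α t φ z := by
  have hs : 0 < α * t / 2 := by positivity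
  have e : ∀ z, Fock.berezinIntegrand α t φ z =
      fun w => φ w * (Fock.gauss (α * t / 2) z w : ℂ) := by
    intro z
    funext w
    rw [Fock.berezinIntegrand, Fock.gauss, div_mul_eq_mul_div]
  have e' : Fock.berezin α t φ =
      fun z => (α / Real.pi : ℂ) * Fock.heat φ (α * t / 2) z := by
    funext z
    rw [Fock.berezin, e, Fock.heat]
  refine ⟨fun z => e z ▸ hφ.integrable_mul_gauss hs z, ?_⟩
  obtain ⟨T, hT, hc⟩ := hT
  have hTk := Fock.tendsto_map_unitKernel hα hφ hT hc
  -- Boundedness of `T` gives the uniform bound; compactness, through `hTk`, gives the decay.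
  have hM : ∀ z, ‖Fock.heat φ α z‖ ≤ Real.pi / α * ‖T‖ := fun z =>
    (Fock.norm_heat_le hα hT z).trans (mul_le_mul_of_nonneg_left
      (T.unit_le_opNorm _ (Fock.norm_unitKernel_le hα.le z)) (by have := Real.pi_pos; positivity))
  have h0 : Tendsto (Fock.heat φ α) (cocompact ℂ) (𝓝 0) := by
    refine squeeze_zero_norm (Fock.norm_heat_le hα hT) ?_
    simpa using hTk.norm.const_mul (Real.pi / α)
  refine ⟨⟨⟨Fock.berezin α t φ, ?_⟩, ?_⟩, fun z => rfl⟩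
  · rw [e']
    exact continuous_const.mul (hφ.continuous_heat hs)
  · change Tendsto (Fock.berezin α t φ) (cocompact ℂ) (𝓝 0)
    rw [e']
    simpa using (hφ.tendsto_heat hα hM h0 hs).const_mul (α / Real.pi : ℂ)
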